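/- Let $0<s<1$ be rational, and let $\mathcal{H}^s$ denote $s$-dimensional Hausdorff measure on Cantor space $2^\omega$ with the metric $d(x,y)=2^{-\min\{n\,:\,x(n)\ne y(n)\}}$ for $x\neq y$. A class of elements of $2^\omega$ or of $\omega^\omega$ is (lightface) $\Sigma^1_1$ if it has the form $\{x : \exists g\in\omega^\omega\ \forall n\ R(x\restriction n, g\restriction n)\}$ with $R$ a recursive relation on finite strings. For $f\in\omega^\omega$, a class in $2^\omega$ is $\Pi^0_1(f)$ if it has the form $\{x : \forall n\ R(x\restriction n)\}$ with $R$ a relation on finite strings that is recursive in $f$. A set $B\subseteq\omega^\omega$ is a basis for $\Sigma^1_1$ if every nonempty $\Sigma^1_1$ class in $\omega^\omega$ has a member in $B$. (1) For every basis $B\subseteq\omega^\omega$ for $\Sigma^1_1$ and every $\Sigma^1_1$ class $E\subseteq 2^\omega$ with $\mathcal{H}^s(E)\neq 0$, there is some $f\in B$ such that $E$ has a $\Pi^0_1(f)$ subclass of non-zero $\mathcal{H}^s$-measure. (2) In particular, every $\Sigma^1_1$ class $E\subseteq 2^\omega$ with $\mathcal{H}^s(E)\neq 0$ has a $\Pi^0_1(\mathcal{O})$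 subclass of non-zero $\mathcal{H}^s$-measure, where $\mathcal{O}\subseteq\omega$ is Kleene's set of ordinal notations (used as an oracle through its characteristic function). -/

import Mathlib

open MeasureTheory

/-- The initial segment `x ↾ n = ⟨x 0, …, x (n - 1)⟩` of an infinite sequence. -/
def initSeg {α : Type} (x : ℕ → α) (n : ℕ) : List α :=
  (List.range n).map x

/-- The (lightface) `Σ¹₁` classes of infinite sequences over `α`; here `α = ℕ` gives Baire space
and `α = Bool` gives Cantor space. A class is `Σ¹₁` if it has the form
`{x : ∃ g ∈ ω^ω, ∀ n, R (x ↾ n, g ↾ n)}` for a recursive relation `R` on finite strings. -/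
def IsSigma11 {α : Type} [Primcodable α] (E : Set (ℕ → α)) : Prop :=
  ∃ R : List α × List ℕ → Bool, Computable R ∧
    E = {x | ∃ g : ℕ → ℕ, ∀ n, R (initSeg x n, initSeg g n) = true}

/-- The `Π⁰₁(f)` classes in Cantor space: those of the form `{x : ∀ n, R (x ↾ n)}` with `R` a
relation on finite binary strings that is recursive in `f`. -/
def IsPi01In (f : ℕ → ℕ) (C : Set (ℕ → Bool)) : Prop :=
  ∃ R : List Bool → Bool, ComputableIn {(f : ℕ →. ℕ)} R ∧
    C = {x | ∀ n, R (initSeg x n) = true}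

/-- `B ⊆ ω^ω` is a basis for `Σ¹₁` if each nonempty `Σ¹₁` class in `ω^ω` has a member in `B`. -/
def IsSigma11Basis (B : Set (ℕ → ℕ)) : Prop :=
  ∀ A : Set (ℕ → ℕ), IsSigma11 A → A.Nonempty → ∃ f ∈ A, f ∈ B

/-- `s`-dimensional Hausdorff measure on Cantor space with the metric
`d(x, y) = 2 ^ (- min {n : x n ≠ y n})` for `x ≠ y`. -/
noncomputable def cantorHausdorff (s : ℝ) : Measure (ℕ → Bool) :=
  letI : MetricSpace (ℕ → Bool) := PiNat.metricSpace
  Measure.hausdorffMeasure s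

/-- The ordering `<_O` of Kleene's ordinal notations: `1` denotes `0`, `2 ^ b` denotes the
successor of the ordinal denoted by `b`, and `3 * 5 ^ e` denotes the limit of the ordinals denoted
by `φ_e 0 <_O φ_e 1 <_O …` where `φ_e` is the partial recursive function with index `e`, which
has to be total. It is the least transitive relation with these closure properties. -/
inductive KleeneLT : ℕ → ℕ → Prop
  | one_two : KleeneLT 1 2
  | succ {a b : ℕ} : KleeneLT a b → KleeneLT b (2 ^ b)
  | lim (c : Nat.Partrec.Code) (φ : ℕ → ℕ) (n : ℕ) : (∀ k, φ k ∈ c.eval k) →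
      (∀ k, KleeneLT (φ k) (φ (k + 1))) → KleeneLT (φ n) (3 * 5 ^ Encodable.encode c)
  | trans {a b c : ℕ} : KleeneLT a b → KleeneLT b c → KleeneLT a c

/-- Kleene's `O`, the set of ordinal notations: the field of `<_O`. -/
def KleeneO : Set ℕ :=
  {a | ∃ b, KleeneLT a b ∨ KleeneLT b a}

open Classical in
/-- The characteristic function of Kleene's `O`. -/
noncomputable def kleeneOChar (n : ℕ) : ℕ :=
  if n ∈ KleeneO then 1 else 0

/-! Hausdorff measure has the same null sets as Hausdorff content, where the covers are by cylinders
of any size. Content is strongly subadditive, hence continuous along increasing unions of arbitrary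
sets (`content_iUnion_le`). By Choquet's capacitability argument the witnesses `g` for `x ∈ E` can
then be bounded by a single `h` while the content stays nonzero (`exists_bound_content_ne_zero`).

As in Frostman's lemma, a set of nonzero content carries a mass distribution (`exists_mass`), and a
mass distribution forces its support to have nonzero content (`content_ne_zero_of_mass`). Masses are
natural numbers, counted at level `k` in units of `4 ^ (-k) / K`, and need only be superadditive, so
rounding is harmless. As `s` is rational, comparing a mass with the weight of a cylinder is integer
arithmetic.

A code `f` bundles masses, bounds and finite witnesses, subject to local recursive conditions. So
for fixed `K` the codes form a `Π⁰₁` class in Baire space, nonempty for some `K`. Every code in it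
serves, not just the constructed one: its support is `Π⁰₁(f)`, has nonzero measure, and lies in `E`
because the bounded finite witnesses have a limit (`massSupport_subset`).

Part (1) applies the basis to the class of codes. For part (2), `O` decides which nodes of a
recursive tree have ill-founded subtrees, and following the least such child gives a code recursive
in `O` (`exists_recursiveIn_kleeneOChar`). -/

open scoped ENNReal Topology

/-! ### Initial segments of infinite sequences -/

section InitSeg

variable {α : Type}

@[simp] theorem initSeg_zero (x : ℕ → α) : initSeg x 0 = [] := rfl

theorem initSeg_succ (x : ℕ → α) (n : ℕ) : initSeg x (n + 1) = initSeg x n ++ [x n] := by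
  simp [initSeg, List.range_succ]

@[simp] theorem length_initSeg (x : ℕ → α) (n : ℕ) : (initSeg x n).length = n := by
  simp [initSeg]

theorem take_initSeg (x : ℕ → α) (m n : ℕ) : (initSeg x n).take m = initSeg x (min m n) := by
  simp [initSeg, ← List.map_take, List.take_range]

theorem initSeg_eq_initSeg {x y : ℕ → α} {n : ℕ} :
    initSeg x n = initSeg y n ↔ ∀ i < n, x i = y i := by
  simp [initSeg]

theorem getElem?_initSeg (x : ℕ → α) {i n : ℕ} (h : i < n) : (initSeg x n)[i]? = some (x i) := by
  simp [initSeg, h]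

/-- A property of finite strings that can always be prolonged holds along an infinite sequence. -/
theorem exists_path (P : List α → Prop) (h0 : P []) (hs : ∀ σ, P σ → ∃ a, P (σ ++ [a])) :
    ∃ x : ℕ → α, ∀ n, P (initSeg x n) := by
  choose f hf using hs
  let T : ℕ → {σ : List α // P σ} := fun n =>
    Nat.rec ⟨[], h0⟩ (fun _ σ => ⟨σ.1 ++ [f σ.1 σ.2], hf σ.1 σ.2⟩) n
  refine ⟨fun n => f (T n).1 (T n).2, fun n => ?_⟩
  have : initSeg (fun n => f (T n).1 (T n).2) n = (T n).1 := by
    induction n with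
    | zero => rfl
    | succ n ih => rw [initSeg_succ, ih]
  rw [this]
  exact (T n).2

end InitSeg

/-! ### Hausdorff content and its continuity along increasing unions -/

section Content

/-- The set `S` of finite strings covers `A`: each member of `A` has an initial segment in `S`. -/
def Covers (A : Set (ℕ → Bool)) (S : Set (List Bool)) : Prop :=
  ∀ x ∈ A, ∃ n, initSeg x n ∈ S

/-- The total weight of a set of strings, a string of length `k` having weight `w k`. -/
noncomputable def weightSum (w : ℕ → ℝ≥0∞) (S : Set (List Bool)) : ℝ≥0∞ :=
  ∑' σ, S.indicator (fun σ => w σ.length) σ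

/-- The content of `A`: the infimum of the weights of the covers of `A` by cylinders. -/
noncomputable def content (w : ℕ → ℝ≥0∞) (A : Set (ℕ → Bool)) : ℝ≥0∞ :=
  ⨅ (S : Set (List Bool)) (_ : Covers A S), weightSum w S

/-- The members of `S` without a proper initial segment in `S`. -/
def topmost (S : Set (List Bool)) : Set (List Bool) :=
  {σ | σ ∈ S ∧ ∀ n < σ.length, σ.take n ∉ S}

variable {w : ℕ → ℝ≥0∞} {A B : Set (ℕ → Bool)} {S T : Set (List Bool)}

theorem Covers.mono (h : Covers A S) (hBA : B ⊆ A) (hST : S ⊆ T) : Covers B T :=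
  fun x hx => (h x (hBA hx)).imp fun _ hn => hST hn

theorem weightSum_mono (h : S ⊆ T) : weightSum w S ≤ weightSum w T :=
  ENNReal.tsum_le_tsum fun σ => Set.indicator_le_indicator_of_subset h (fun _ => zero_le) σ

theorem weightSum_union_le : weightSum w (S ∪ T) ≤ weightSum w S + weightSum w T := by
  rw [weightSum, weightSum, weightSum, ← ENNReal.tsum_add]
  refine ENNReal.tsum_le_tsum fun σ => ?_
  by_cases h1 : σ ∈ S <;> by_cases h2 : σ ∈ T <;> simp [h1, h2]

theorem le_weightSum {σ : List Bool} (h : σ ∈ S) : w σ.length ≤ weightSum w S := by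
  have := ENNReal.le_tsum (f := S.indicator (fun σ => w σ.length)) σ
  simpa [h, weightSum] using this

theorem weightSum_le_tsum {ι : Type*} (σ : ι → List Bool) (h : S ⊆ Set.range σ) :
    weightSum w S ≤ ∑' i, w (σ i).length := by
  rw [weightSum, ← tsum_subtype]
  have hs : ∀ τ : S, ∃ i, σ i = τ := fun τ => h τ.2
  choose g hg using hs
  have hinj : Function.Injective g := fun a b hab => by
    apply Subtype.ext; rw [← hg a, ← hg b, hab]
  calc ∑' τ : S, w τ.1.length = ∑' τ : S, w (σ (g τ)).length := by simp_rw [hg]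
    _ ≤ _ := ENNReal.tsum_comp_le_tsum_of_injective hinj (fun i => w (σ i).length)

theorem content_le (h : Covers A S) : content w A ≤ weightSum w S :=
  iInf₂_le S h

theorem exists_covers_of_content_lt {b : ℝ≥0∞} (h : content w A < b) :
    ∃ S, Covers A S ∧ weightSum w S < b := by
  simpa [content, iInf_lt_iff] using h

theorem content_mono (h : A ⊆ B) : content w A ≤ content w B :=
  le_iInf₂ fun _ hS => content_le (hS.mono h subset_rfl)

theorem content_union_le : content w (A ∪ B) ≤ content w A + content w B := by
  refine ENNReal.le_of_forall_pos_le_add fun ε hε hlt => ?_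
  have hε2 : (ε / 2 : ℝ≥0∞) ≠ 0 := by simpa using hε.ne'
  obtain ⟨hA, hB⟩ := ENNReal.add_lt_top.1 hlt
  obtain ⟨S, hS, hSw⟩ := exists_covers_of_content_lt (ENNReal.lt_add_right hA.ne hε2)
  obtain ⟨T, hT, hTw⟩ := exists_covers_of_content_lt (ENNReal.lt_add_right hB.ne hε2)
  have hc : Covers (A ∪ B) (S ∪ T) := by
    rintro x (hx | hx)
    · exact (hS x hx).imp fun n hn => Or.inl hn
    · exact (hT x hx).imp fun n hn => Or.inr hn
  refine (content_le hc).trans (weightSum_union_le.trans ((add_le_add hSw.le hTw.le).trans ?_))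
  rw [add_add_add_comm, ENNReal.add_halves]

theorem content_le_weight {σ : List Bool} (h : ∀ x ∈ A, initSeg x σ.length = σ) :
    content w A ≤ w σ.length := by
  refine (content_le (S := {σ}) fun x hx => ⟨σ.length, h x hx⟩).trans ?_
  simpa using weightSum_le_tsum (w := w) (fun _ : Unit => σ) (S := {σ}) (by simp)

theorem Covers.topmost (h : Covers A S) : Covers A (topmost S) := by
  classical
  intro x hx
  have hn := h x hx
  refine ⟨Nat.find hn, Nat.find_spec hn, fun m hm => ?_⟩
  rw [length_initSeg] at hm
  rw [take_initSeg, min_eq_left hm.le]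
  exact Nat.find_min hn hm

theorem topmost_subset : topmost S ⊆ S := fun _ h => h.1

theorem topmost_union_subset : topmost (S ∪ T) ⊆ topmost (topmost S ∪ T) := by
  rintro σ ⟨h, h'⟩
  refine ⟨h.imp (fun h => ⟨h, fun n hn hS => h' n hn (Or.inl hS)⟩) id, fun n hn => ?_⟩
  rintro (hS | hT)
  · exact h' n hn (Or.inl hS.1)
  · exact h' n hn (Or.inr hT)

/-- Strong subadditivity of the content. -/
theorem weightSum_topmost_add_content_le (hS : Covers A S) (hT : Covers A T) :
    weightSum w (topmost (S ∪ T)) + content w A ≤ weightSum w S + weightSum w T := by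
  -- Each point of `A` passes through a string of `S` and one of `T`. If they coincide, the string
  -- lies in `S ∩ T`; otherwise the longer one is not topmost. So the strings that are counted twice
  -- or discarded still cover `A`.
  have hc : Covers A (((S ∪ T) \ topmost (S ∪ T)) ∪ (S ∩ T)) := by
    intro x hx
    obtain ⟨n, hn⟩ := hS x hx
    obtain ⟨m, hm⟩ := hT x hx
    rcases lt_trichotomy n m with h | rfl | h
    · refine ⟨m, Or.inl ⟨Or.inr hm, fun hmin => hmin.2 n (by simpa using h) ?_⟩⟩
      rw [take_initSeg, min_eq_left h.le]
      exact Or.inl hn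
    · exact ⟨n, Or.inr ⟨hn, hm⟩⟩
    · refine ⟨n, Or.inl ⟨Or.inl hn, fun hmin => hmin.2 m (by simpa using h) ?_⟩⟩
      rw [take_initSeg, min_eq_left h.le]
      exact Or.inr hm
  refine (add_le_add_right (content_le hc) _).trans ?_
  rw [weightSum, weightSum, weightSum, weightSum, ← ENNReal.tsum_add, ← ENNReal.tsum_add]
  refine ENNReal.tsum_le_tsum fun σ => ?_
  have ht : σ ∈ topmost (S ∪ T) → σ ∈ S ∨ σ ∈ T := fun h => h.1
  by_cases h1 : σ ∈ S <;> by_cases h2 : σ ∈ T <;> by_cases h3 : σ ∈ topmost (S ∪ T) <;>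
    simp_all

/-- The content is continuous along increasing unions of arbitrary sets. -/
theorem content_iUnion_le {A : ℕ → Set (ℕ → Bool)} (hA : Monotone A) {b : ℝ≥0∞}
    (hb : ∀ n, content w (A n) ≤ b) : content w (⋃ n, A n) ≤ b := by
  rcases eq_or_ne b ⊤ with rfl | hbt
  · exact le_top
  have hfin : ∀ n, content w (A n) ≠ ⊤ := fun n => ne_top_of_le_ne_top hbt (hb n)
  refine ENNReal.le_of_forall_pos_le_add fun ε hε _ => ?_
  obtain ⟨δ, hδ, hsum⟩ := ENNReal.exists_pos_sum_of_countable' (ENNReal.coe_pos.2 hε).ne' ℕ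
  have hS : ∀ n, ∃ S, Covers (A n) S ∧ weightSum w S < content w (A n) + δ n := fun n =>
    exists_covers_of_content_lt (ENNReal.lt_add_right (hfin n) (hδ n).ne')
  choose S hSc hSw using hS
  -- Near-optimal covers are merged one by one and only topmost strings are kept; by strong
  -- subadditivity the weight exceeds the content of `A n` only by the accumulated errors `δ`.
  let X : ℕ → Set (List Bool) := Set.accumulate S
  have hXs : ∀ n, X (n + 1) = X n ∪ S (n + 1) := fun n => Set.accumulate_succ S n
  have hle : ∀ n, weightSum w (topmost (X n)) ≤
      content w (A n) + ∑ i ∈ Finset.range (n + 1), δ i := by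
    intro n
    induction n with
    | zero =>
      have : X 0 = S 0 := by simp [X, Set.accumulate_def]
      rw [this]
      simpa using (weightSum_mono topmost_subset).trans (hSw 0).le
    | succ n ih =>
      have h1 : Covers (A n) (topmost (X n)) :=
        ((hSc n).mono subset_rfl (Set.subset_accumulate (s := S))).topmost
      have h2 : Covers (A n) (S (n + 1)) := (hSc (n + 1)).mono (hA n.le_succ) subset_rfl
      have h3 := (weightSum_topmost_add_content_le (w := w) h1 h2).trans
        (add_le_add ih (hSw (n + 1)).le)
      refine (weightSum_mono ((hXs n).symm ▸ topmost_union_subset)).trans ?_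
      refine (ENNReal.add_le_add_iff_right (hfin n)).1 (h3.trans (le_of_eq ?_))
      rw [Finset.sum_range_succ _ (n + 1)]
      ring
  have hcov : Covers (⋃ n, A n) (topmost (⋃ n, X n)) := by
    refine Covers.topmost fun x hx => ?_
    obtain ⟨n, hn⟩ := Set.mem_iUnion.1 hx
    exact (hSc n x hn).imp fun m hm =>
      Set.mem_iUnion.2 ⟨n, Set.subset_accumulate hm⟩
  refine (content_le hcov).trans ?_
  rw [weightSum, ENNReal.tsum_eq_iSup_sum]
  refine iSup_le fun F => ?_
  -- A string that is topmost in the whole union is topmost in every `X n` containing it, so one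
  -- stage serves all of the finite set `F`.
  have hn : ∃ n, ∀ σ ∈ F, σ ∈ topmost (⋃ n, X n) → σ ∈ topmost (X n) := by
    have : ∀ σ, ∃ n, σ ∈ topmost (⋃ n, X n) → σ ∈ X n := fun σ => by
      by_cases h : σ ∈ topmost (⋃ n, X n)
      · exact (Set.mem_iUnion.1 h.1).imp fun n hn _ => hn
      · exact ⟨0, fun h' => absurd h' h⟩
    choose N hN using this
    refine ⟨F.sup N, fun σ hσ h => ⟨?_, fun m hm h' => h.2 m hm (Set.mem_iUnion.2 ⟨_, h'⟩)⟩⟩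
    exact Set.monotone_accumulate (Finset.le_sup hσ) (hN σ h)
  obtain ⟨n, hn⟩ := hn
  calc ∑ σ ∈ F, (topmost (⋃ n, X n)).indicator (fun σ => w σ.length) σ
      ≤ ∑ σ ∈ F, (topmost (X n)).indicator (fun σ => w σ.length) σ := by
        refine Finset.sum_le_sum fun σ hσ => ?_
        by_cases h : σ ∈ topmost (⋃ n, X n)
        · simp [h, hn σ hσ h]
        · simp [h]
    _ ≤ weightSum w (topmost (X n)) := ENNReal.sum_le_tsum F
    _ ≤ content w (A n) + ∑ i ∈ Finset.range (n + 1), δ i := hle n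
    _ ≤ b + ε := add_le_add (hb n) ((ENNReal.sum_le_tsum _).trans hsum.le)

end Content

/-! ### Hausdorff measure and content have the same null sets -/

section Hausdorff

/-- The weight `(2 ^ (-k)) ^ s` of a cylinder of length `k`. -/
noncomputable def cantorWeight (s : ℝ) (k : ℕ) : ℝ≥0∞ :=
  ((2 : ℝ≥0∞)⁻¹ ^ k) ^ s

attribute [local instance] PiNat.metricSpace

theorem edist_eq_of_ne {x y : ℕ → Bool} (h : x ≠ y) :
    edist x y = (2 : ℝ≥0∞)⁻¹ ^ PiNat.firstDiff x y := by
  rw [edist_dist, PiNat.dist_eq_of_ne h, one_div, ENNReal.ofReal_pow (by positivity),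
    ENNReal.ofReal_inv_of_pos (by norm_num)]
  simp

theorem ediam_le_of_initSeg_eq {t : Set (ℕ → Bool)} {σ : List Bool}
    (h : ∀ x ∈ t, initSeg x σ.length = σ) : Metric.ediam t ≤ (2 : ℝ≥0∞)⁻¹ ^ σ.length := by
  refine Metric.ediam_le fun x hx y hy => ?_
  rcases eq_or_ne x y with rfl | hne
  · simp
  · rw [edist_eq_of_ne hne]
    refine pow_le_pow_right_of_le_one' (by simp) ?_
    refine (PiNat.mem_cylinder_iff_le_firstDiff hne _).1 ?_
    exact initSeg_eq_initSeg.1 ((h x hx).trans (h y hy).symm)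

variable {s : ℝ}

theorem tendsto_cantorWeight (hs : 0 < s) :
    Filter.Tendsto (cantorWeight s) Filter.atTop (𝓝 0) := by
  have h1 : Filter.Tendsto (fun k : ℕ => (2 : ℝ≥0∞)⁻¹ ^ k) Filter.atTop (𝓝 0) :=
    ENNReal.tendsto_pow_atTop_nhds_zero_of_lt_one (by simp)
  have h2 := h1.ennrpow_const s
  rwa [ENNReal.zero_rpow_of_pos hs] at h2

theorem exists_cylinder_superset (hs : 0 < s) (t : Set (ℕ → Bool)) {ε : ℝ≥0∞} (hε : 0 < ε) :
    ∃ σ : List Bool, (∀ x ∈ t, initSeg x σ.length = σ) ∧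
      cantorWeight s σ.length ≤ (⨆ _ : t.Nonempty, Metric.ediam t ^ s) + ε := by
  classical
  -- A set with at most one point has diameter `0`, while every cylinder has positive weight; a
  -- cylinder of weight below `ε` serves such sets.
  obtain ⟨k, hk⟩ := ((tendsto_cantorWeight hs).eventually_lt_const hε).exists
  by_cases h : t.Subsingleton
  · rcases t.eq_empty_or_nonempty with rfl | ⟨x, hx⟩
    · exact ⟨List.replicate k true, by simp, by simpa using hk.le⟩
    · refine ⟨initSeg x k, fun y hy => by rw [h hy hx, length_initSeg], ?_⟩
      rw [length_initSeg]
      exact hk.le.trans le_add_self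
  · have hex : ∃ n, ∃ x ∈ t, ∃ y ∈ t, x ≠ y ∧ PiNat.firstDiff x y = n := by
      obtain ⟨x, hx, y, hy, hne⟩ := Set.not_subsingleton_iff.1 h
      exact ⟨_, x, hx, y, hy, hne, rfl⟩
    obtain ⟨x, hx, y, hy, hne, hxy⟩ := Nat.find_spec hex
    refine ⟨initSeg x (Nat.find hex), fun z hz => ?_, ?_⟩
    · rw [length_initSeg]
      rcases eq_or_ne z x with rfl | hzx
      · rfl
      refine initSeg_eq_initSeg.2 ((PiNat.mem_cylinder_iff_le_firstDiff hzx _).2 ?_)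
      exact Nat.find_min' hex ⟨z, hz, x, hx, hzx, rfl⟩
    · rw [length_initSeg]
      refine le_trans ?_ (le_add_right (le_iSup_of_le ⟨x, hx⟩ le_rfl))
      refine ENNReal.rpow_le_rpow ?_ hs.le
      rw [← hxy, ← edist_eq_of_ne hne]
      exact Metric.edist_le_ediam_of_mem hx hy

theorem content_eq_zero_of_cantorHausdorff_eq_zero (hs : 0 < s) {A : Set (ℕ → Bool)}
    (h : cantorHausdorff s A = 0) : content (cantorWeight s) A = 0 := by
  rw [cantorHausdorff, Measure.hausdorffMeasure_apply] at h
  refine le_antisymm (le_of_forall_pos_le_add fun ε hε => ?_) zero_le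
  -- Scale `⊤`: the diameters in the cover are unrestricted.
  have h1 := ENNReal.iSup_eq_zero.1 (ENNReal.iSup_eq_zero.1 h ⊤) (by simp)
  have hε2 : 0 < ε / 2 := ENNReal.half_pos hε.ne'
  have h2 := h1.trans_lt hε2
  simp only [iInf_lt_iff] at h2
  obtain ⟨t, hAt, -, ht⟩ := h2
  obtain ⟨δ, hδ, hsum⟩ := ENNReal.exists_pos_sum_of_countable' hε2.ne' ℕ
  choose σ hσ hw using fun n => exists_cylinder_superset hs (t n) (hδ n)
  have hc : Covers A (Set.range σ) := fun x hx => by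
    obtain ⟨n, hn⟩ := Set.mem_iUnion.1 (hAt hx)
    exact ⟨(σ n).length, n, (hσ n x hn).symm⟩
  calc content (cantorWeight s) A ≤ weightSum (cantorWeight s) (Set.range σ) := content_le hc
    _ ≤ ∑' n, cantorWeight s (σ n).length := weightSum_le_tsum σ subset_rfl
    _ ≤ ∑' n, ((⨆ _ : (t n).Nonempty, Metric.ediam (t n) ^ s) + δ n) := ENNReal.tsum_le_tsum hw
    _ ≤ ε / 2 + ε / 2 := by rw [ENNReal.tsum_add]; exact add_le_add ht.le hsum.le
    _ = 0 + ε := by rw [ENNReal.add_halves, zero_add]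

/-- Covers of small weight are automatically fine: if the total weight is below that of level `n`,
each cylinder used has diameter at most `2 ^ (-n)`. -/
theorem cantorHausdorff_eq_zero_of_content_eq_zero (hs : 0 < s) {A : Set (ℕ → Bool)}
    (h : content (cantorWeight s) A = 0) : cantorHausdorff s A = 0 := by
  have hpos : ∀ n, 0 < cantorWeight s n := fun n =>
    ENNReal.rpow_pos (pos_iff_ne_zero.2 (pow_ne_zero n (by simp))) (by simp)
  choose S hSc hSw using fun n => exists_covers_of_content_lt (h.trans_lt (hpos n))
  have key := Measure.hausdorffMeasure_le_liminf_tsum s A (l := Filter.atTop)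
    (fun n : ℕ => (2 : ℝ≥0∞)⁻¹ ^ n)
    (ENNReal.tendsto_pow_atTop_nhds_zero_of_lt_one (by simp))
    (fun n (σ : S n) => {x | initSeg x σ.1.length = σ.1})
    (Filter.Eventually.of_forall fun n σ =>
      (ediam_le_of_initSeg_eq (σ := σ.1) fun x hx => hx).trans ?_)
    (Filter.Eventually.of_forall fun n x hx => ?_)
  · refine le_antisymm (key.trans ?_) zero_le
    refine (Filter.liminf_le_liminf (Filter.Eventually.of_forall fun n => ?_)).trans
      (tendsto_cantorWeight hs).liminf_eq.le
    refine le_trans ?_ (hSw n).le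
    rw [weightSum, ← tsum_subtype]
    exact ENNReal.tsum_le_tsum fun σ =>
      ENNReal.rpow_le_rpow (ediam_le_of_initSeg_eq fun x hx => hx) hs.le
  · have := (le_weightSum σ.2).trans_lt (hSw n)
    exact ((ENNReal.rpow_lt_rpow_iff hs).1 this).le
  · obtain ⟨m, hm⟩ := hSc n x hx
    exact Set.mem_iUnion.2 ⟨⟨_, hm⟩, by simp⟩

theorem cantorHausdorff_ne_zero_iff (hs : 0 < s) {A : Set (ℕ → Bool)} :
    cantorHausdorff s A ≠ 0 ↔ content (cantorWeight s) A ≠ 0 :=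
  not_congr ⟨content_eq_zero_of_cantorHausdorff_eq_zero hs,
    cantorHausdorff_eq_zero_of_content_eq_zero hs⟩

end Hausdorff

/-! ### Mass distributions (Frostman's lemma) -/

section Mass

variable {w : ℕ → ℝ≥0∞}

theorem weightSum_append_add_le (S : Set (List Bool)) (σ : List Bool) :
    weightSum w (S ∩ {τ | σ ++ [false] <+: τ}) + weightSum w (S ∩ {τ | σ ++ [true] <+: τ}) ≤
      weightSum w (S ∩ {τ | σ <+: τ}) := by
  rw [weightSum, weightSum, weightSum, ← ENNReal.tsum_add]
  refine ENNReal.tsum_le_tsum fun τ => ?_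
  have h (a : Bool) : σ ++ [a] <+: τ → σ <+: τ := (List.prefix_append σ [a]).trans
  have h' : σ ++ [false] <+: τ → ¬ σ ++ [true] <+: τ := fun h1 h2 => by
    simpa using List.prefix_of_prefix_length_le h1 h2 (by simp)
  have h0 := h false
  have h1 := h true
  by_cases hS : τ ∈ S <;> by_cases ha : σ ++ [false] <+: τ <;>
    by_cases hb : σ ++ [true] <+: τ <;> simp_all

/-- A mass distribution on the tree of binary strings, in integer units that shrink fourfold with
each level, bounds the weight of the covers of its support from below. -/
theorem le_mul_weightSum_of_mass {K : ℕ} {N : List Bool → ℕ} (h0 : 0 < N [])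
    (hsplit : ∀ σ, 4 * N σ ≤ N (σ ++ [false]) + N (σ ++ [true]))
    (hle : ∀ σ, (N σ : ℝ≥0∞) ≤ w σ.length * (4 ^ σ.length * K)) {S : Set (List Bool)}
    (hS : Covers {x | ∀ n, 0 < N (initSeg x n)} S) : 1 ≤ K * weightSum w S := by
  by_contra! hlt
  -- `P σ` says that `S` is too light above `σ` for the mass at `σ`. As mass is superadditive and
  -- the parts of `S` above the two children are disjoint, `P` passes to some child. The resulting
  -- path lies in the support, so it meets `S`, and there `hle` fails.
  let P : List Bool → Prop := fun σ =>
    K * 4 ^ σ.length * weightSum w (S ∩ {τ | σ <+: τ}) < N σ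
  obtain ⟨x, hx⟩ := exists_path P (by
    have : (1 : ℝ≥0∞) ≤ N [] := by exact_mod_cast h0
    simpa [P] using hlt.trans_le this) (fun σ hσ => by
    by_contra! hcon
    have h1 := hcon false
    have h2 := hcon true
    simp only [P, not_lt, List.length_append, List.length_singleton] at h1 h2
    have h3 : (4 : ℝ≥0∞) * N σ ≤ N (σ ++ [false]) + N (σ ++ [true]) := by
      exact_mod_cast hsplit σ
    have h4 := h3.trans (add_le_add h1 h2)
    rw [← mul_add] at h4
    have h5 := h4.trans (mul_le_mul_right (weightSum_append_add_le S σ) _)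
    have h6 : (4 : ℝ≥0∞) * N σ ≤
        4 * (K * 4 ^ σ.length * weightSum w (S ∩ {τ | σ <+: τ})) :=
      h5.trans (le_of_eq (by ring))
    exact absurd ((ENNReal.mul_le_mul_iff_right (by simp) (by simp)).1 h6) (not_le.2 hσ))
  obtain ⟨n, hn⟩ := hS x fun n => by
    have := (zero_le).trans_lt (hx n)
    exact_mod_cast this
  have h1 := hx n
  have h2 := le_weightSum (w := w) (S := S ∩ {τ | initSeg x n <+: τ})
    ⟨hn, List.prefix_rfl⟩
  refine absurd (hle (initSeg x n)) (not_le.2 (lt_of_le_of_lt ?_ h1))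
  rw [mul_comm, mul_comm (4 ^ _ : ℝ≥0∞)]
  exact mul_le_mul_right h2 _

theorem content_ne_zero_of_mass {K : ℕ} {N : List Bool → ℕ} (h0 : 0 < N [])
    (hsplit : ∀ σ, 4 * N σ ≤ N (σ ++ [false]) + N (σ ++ [true]))
    (hle : ∀ σ, (N σ : ℝ≥0∞) ≤ w σ.length * (4 ^ σ.length * K)) :
    content w {x | ∀ n, 0 < N (initSeg x n)} ≠ 0 := by
  intro h
  have hK : (K : ℝ≥0∞)⁻¹ ≠ 0 := by simp
  obtain ⟨S, hS, hlt⟩ := exists_covers_of_content_lt (h.trans_lt (pos_iff_ne_zero.2 hK))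
  have := le_mul_weightSum_of_mass h0 hsplit hle hS
  rw [mul_comm] at this
  exact absurd (ENNReal.mul_lt_of_lt_div (by rwa [one_div])) (not_lt.2 this)

/-- A set of nonzero content carries a mass distribution. -/
theorem exists_mass (hw : ∀ k, w k ≤ 1) {C : Set (ℕ → Bool)} (hC : content w C ≠ 0) :
    ∃ (K : ℕ) (N : List Bool → ℕ), 0 < N [] ∧
      (∀ σ, 4 * N σ ≤ N (σ ++ [false]) + N (σ ++ [true])) ∧
      (∀ σ, (N σ : ℝ≥0∞) ≤ w σ.length * (4 ^ σ.length * K)) ∧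
      ∀ σ, 0 < N σ → ∃ x ∈ C, initSeg x σ.length = σ := by
  let D : List Bool → Set (ℕ → Bool) := fun σ => C ∩ {x | initSeg x σ.length = σ}
  have hDw : ∀ σ, content w (D σ) ≤ w σ.length := fun σ => content_le_weight fun x hx => hx.2
  have hDf : ∀ σ, content w (D σ) ≠ ⊤ := fun σ =>
    ne_top_of_le_ne_top ENNReal.one_ne_top ((hDw σ).trans (hw _))
  let c : List Bool → ℝ := fun σ => (content w (D σ)).toReal
  have hc0 : ∀ σ, 0 ≤ c σ := fun σ => ENNReal.toReal_nonneg
  have hcs : ∀ σ, c σ ≤ c (σ ++ [false]) + c (σ ++ [true]) := fun σ => by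
    have h : D σ ⊆ D (σ ++ [false]) ∪ D (σ ++ [true]) := by
      rintro x ⟨hx, hxσ⟩
      have hxσ : initSeg x σ.length = σ := hxσ
      cases hb : x σ.length
      · exact Or.inl ⟨hx, by simp [initSeg_succ, hxσ, hb]⟩
      · exact Or.inr ⟨hx, by simp [initSeg_succ, hxσ, hb]⟩
    rw [← ENNReal.toReal_add (hDf _) (hDf _)]
    exact ENNReal.toReal_mono (ENNReal.add_ne_top.2 ⟨hDf _, hDf _⟩)
      ((content_mono h).trans content_union_le)
  have hroot : 0 < c [] := by
    have : D [] = C := by simp [D]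
    exact ENNReal.toReal_pos (by rwa [this]) (hDf [])
  obtain ⟨K, hK⟩ := exists_nat_ge (2 / c [])
  rw [div_le_iff₀ hroot] at hK
  -- Subtracting `1` pays for rounding: each child loses less than `2` units, and the parent's loss
  -- of at least `1` becomes `4` after scaling. The choice `K ≥ 2 / c []` leaves at least one unit
  -- at the root.
  let N : List Bool → ℕ := fun σ => ⌊c σ * (4 ^ σ.length * K) - 1⌋₊
  have hNle : ∀ σ, 0 < N σ → (N σ : ℝ) ≤ c σ * (4 ^ σ.length * K) - 1 := fun σ h =>
    Nat.floor_le (Nat.pos_of_floor_pos h).le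
  refine ⟨K, N, ?_, fun σ => ?_, fun σ => ?_, fun σ hσ => ?_⟩
  · refine Nat.floor_pos.2 ?_
    simp only [List.length_nil, pow_zero, one_mul]
    linarith
  · rcases Nat.eq_zero_or_pos (N σ) with h | h
    · simp [h]
    have h1 := hNle σ h
    have h2 := Nat.lt_floor_add_one (c (σ ++ [false]) * (4 ^ (σ.length + 1) * K) - 1)
    have h3 := Nat.lt_floor_add_one (c (σ ++ [true]) * (4 ^ (σ.length + 1) * K) - 1)
    have h4 := mul_le_mul_of_nonneg_right (hcs σ) (by positivity : (0 : ℝ) ≤ 4 ^ σ.length * K)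
    have h5 : (4 * N σ : ℝ) ≤ N (σ ++ [false]) + N (σ ++ [true]) := by
      simp only [N, List.length_append, List.length_singleton] at h1 ⊢
      rw [pow_succ] at h2 h3 ⊢
      nlinarith
    exact_mod_cast h5
  · have h1 : (N σ : ℝ) ≤ c σ * (4 ^ σ.length * K) := by
      rcases Nat.eq_zero_or_pos (N σ) with h | h
      · rw [h, Nat.cast_zero]; exact mul_nonneg (hc0 σ) (by positivity)
      · linarith [hNle σ h]
    have h2 := ENNReal.ofReal_le_ofReal h1
    rw [ENNReal.ofReal_natCast, ENNReal.ofReal_mul (hc0 σ), ENNReal.ofReal_toReal (hDf σ)] at h2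
    refine h2.trans (mul_le_mul' (hDw σ) (le_of_eq ?_))
    rw [ENNReal.ofReal_mul (by positivity), ENNReal.ofReal_pow (by norm_num)]
    simp
  · by_contra! hcon
    have hempty : D σ = ∅ := Set.eq_empty_of_forall_notMem fun x hx => hcon x hx.1 hx.2
    have : content w (∅ : Set (ℕ → Bool)) = 0 :=
      le_antisymm ((content_le (S := ∅) fun x hx => hx.elim).trans (by simp [weightSum])) zero_le
    have h1 := hNle σ hσ
    have h2 : c σ = 0 := by simp only [c, hempty, this, ENNReal.toReal_zero]
    rw [h2] at h1
    have h3 : (0 : ℝ) ≤ N σ := Nat.cast_nonneg _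
    linarith

end Mass

/-! ### Compactness and capacitability -/

section Compactness

theorem exists_limit_of_le (h : ℕ → ℕ) (x : ℕ → ℕ → Bool) (g : ℕ → ℕ → ℕ)
    (hg : ∀ n i, g n i ≤ h i) :
    ∃ (y : ℕ → Bool) (f : ℕ → ℕ), (∀ i, f i ≤ h i) ∧ ∀ m N, ∃ n ≥ N,
      initSeg (x n) m = initSeg y m ∧ initSeg (g n) m = initSeg f m := by
  have hK : IsCompact ((Set.univ : Set (ℕ → Bool)) ×ˢ
      (Set.univ.pi fun i => Set.Icc 0 (h i) : Set (ℕ → ℕ))) :=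
    isCompact_univ.prod (isCompact_univ_pi fun i => (Set.finite_Icc _ _).isCompact)
  obtain ⟨⟨y, f⟩, hmem, φ, hφ, hlim⟩ := hK.tendsto_subseq (x := fun n => (x n, g n))
    fun n => ⟨Set.mem_univ _, fun i _ => ⟨Nat.zero_le _, hg n i⟩⟩
  refine ⟨y, f, fun i => (hmem.2 i (Set.mem_univ i)).2, fun m N => ?_⟩
  rw [nhds_prod_eq, Filter.tendsto_prod_iff'] at hlim
  have hy : ∀ i, ∀ᶠ n in Filter.atTop, x (φ n) i = y i := fun i => by
    simpa [nhds_discrete] using (tendsto_pi_nhds.1 hlim.1) i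
  have hf : ∀ i, ∀ᶠ n in Filter.atTop, g (φ n) i = f i := fun i => by
    simpa [nhds_discrete] using (tendsto_pi_nhds.1 hlim.2) i
  have hall : ∀ᶠ n in Filter.atTop, ∀ i < m, x (φ n) i = y i ∧ g (φ n) i = f i :=
    (Filter.eventually_all_finite (Set.finite_lt_nat m)).2 fun i _ => (hy i).and (hf i)
  obtain ⟨n, hn, hnN⟩ := (hall.and (Filter.eventually_ge_atTop N)).exists
  exact ⟨φ n, hnN.trans (hφ.id_le n), initSeg_eq_initSeg.2 fun i hi => (hn i hi).1,
    initSeg_eq_initSeg.2 fun i hi => (hn i hi).2⟩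

/-- Capacitability: a projection of nonzero content along Baire space still has nonzero content
after restricting the witnesses to a compact set. -/
theorem exists_bound_content_ne_zero {w : ℕ → ℝ≥0∞} (R : List Bool × List ℕ → Bool)
    (hR : content w {x | ∃ g : ℕ → ℕ, ∀ n, R (initSeg x n, initSeg g n) = true} ≠ 0) :
    ∃ h : ℕ → ℕ, content w {x | ∃ g : ℕ → ℕ, (∀ i, g i ≤ h i) ∧
      ∀ n, R (initSeg x n, initSeg g n) = true} ≠ 0 := by
  let A : List ℕ → Set (ℕ → Bool) := fun σ => {x | ∃ g : ℕ → ℕ,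
    (∀ (i : ℕ) (hi : i < σ.length), g i ≤ σ[i]) ∧ ∀ n, R (initSeg x n, initSeg g n) = true}
  obtain ⟨ε, hε, hlt⟩ := exists_between (pos_iff_ne_zero.2 hR)
  -- The bound is built one coordinate at a time: `A σ` is the increasing union of the sets `A (σ ++
  -- [a])`, so some `a` keeps the content above `ε`.
  obtain ⟨h, hh⟩ := exists_path (fun σ => ε < content w (A σ)) (by simpa [A] using hlt)
    (fun σ hσ => by
      by_contra! hcon
      have hmono : Monotone fun a => A (σ ++ [a]) := fun a b hab x ⟨g, hg, hgR⟩ => by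
        refine ⟨g, fun i hi => (hg i (by simpa using hi)).trans ?_, hgR⟩
        rw [List.getElem_append, List.getElem_append]
        split
        · exact le_rfl
        · simpa using hab
      have hsub : A σ ⊆ ⋃ a, A (σ ++ [a]) := fun x ⟨g, hg, hgR⟩ => by
        refine Set.mem_iUnion.2 ⟨g σ.length, g, fun i hi => ?_, hgR⟩
        rw [List.getElem_append]
        split
        · exact hg i _
        · have : i = σ.length := by simp at hi; omega
          simp [this]
      exact absurd hσ (not_lt.2 ((content_mono hsub).trans (content_iUnion_le hmono hcon))))
  refine ⟨h, fun h0 => ?_⟩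
  obtain ⟨S, hS, hSw⟩ := exists_covers_of_content_lt (h0.trans_lt hε)
  have hn : ∀ n, ∃ x : ℕ → Bool, ∃ g : ℕ → ℕ, (∀ i, g i ≤ h i) ∧
      (∀ m ≤ n, R (initSeg x m, initSeg g m) = true) ∧ ∀ m, initSeg x m ∉ S := by
    intro n
    by_contra! hcon
    have hc : Covers (A (initSeg h n)) S := fun x ⟨g, hg, hgR⟩ => by
      -- Past `n` the witness need not obey `h`; zeros do, at the price of keeping `R` only up to
      -- level `n`.
      refine hcon x (fun i => if i < n then g i else 0) (fun i => ?_) fun m hm => ?_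
      · split_ifs with hi
        · simpa [initSeg] using hg i (by simpa using hi)
        · exact Nat.zero_le _
      · have : initSeg (fun i => if i < n then g i else 0) m = initSeg g m :=
          initSeg_eq_initSeg.2 fun i hi => if_pos (hi.trans_le hm)
        rw [this]
        exact hgR m
    exact absurd ((content_le hc).trans_lt hSw) (not_lt.2 (hh n).le)
  choose x g hg hgR hxS using hn
  obtain ⟨y, f, hf, hlim⟩ := exists_limit_of_le h x g hg
  obtain ⟨m, hm⟩ := hS y ⟨f, hf, fun m => by
    obtain ⟨n, hn, h1, h2⟩ := hlim m m
    rw [← h1, ← h2]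
    exact hgR n m hn⟩
  obtain ⟨n, -, h1, -⟩ := hlim m 0
  exact hxS n m (h1 ▸ hm)

end Compactness

/-! ### Codes for mass distributions as a recursive closed class -/

section Codes

/-- The entry of a mass code at a string: the mass of the string, a bound for a coordinate of the
witnesses, and a finite witness. -/
abbrev MassEntry : Type := ℕ × ℕ × List ℕ

/-- The entry with code `n`. -/
def MassEntry.ofCode (n : ℕ) : MassEntry :=
  (Encodable.decode n).getD (0, 0, [])

@[simp] theorem MassEntry.ofCode_encode (e : MassEntry) :
    MassEntry.ofCode (Encodable.encode e) = e := by
  rw [MassEntry.ofCode, Encodable.encodek, Option.getD_some]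

theorem MassEntry.primrec_ofCode : Primrec MassEntry.ofCode :=
  Primrec.option_getD.comp Primrec.decode (Primrec.const _)

/-- The local condition on a mass code at a string `σ` and a coordinate `i`, in terms of the entries
at `σ`, at its two children, and at `i`. -/
def entryCheck (R : List Bool × List ℕ → Bool) (p q K : ℕ)
    (t : (List Bool × ℕ) × MassEntry × MassEntry × MassEntry × MassEntry) : Bool :=
  decide ((¬ t.1.1.length = 0 ∨ 0 < t.2.1.1) ∧ 4 * t.2.1.1 ≤ t.2.2.1.1 + t.2.2.2.1.1 ∧
    t.2.1.1 ^ q * 2 ^ (p * t.1.1.length) ≤ (4 ^ t.1.1.length * K) ^ q) &&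
  (decide (t.2.1.1 = 0) || (decide (t.2.1.2.2.length = t.1.1.length ∧
    t.2.1.2.2.getD t.1.2 0 ≤ t.2.2.2.2.2.1) && R (t.1.1.take t.1.2, t.2.1.2.2.take t.1.2)))

/-- The condition on mass codes that the length of a finite string `l` encodes, evaluated at `l`. -/
def prefixCheck (R : List Bool × List ℕ → Bool) (p q K : ℕ) (l : List ℕ) : Bool :=
  let t : List Bool × ℕ := (Encodable.decode l.length.unpair.1).getD ([], 0)
  let e : ℕ → MassEntry := fun k => MassEntry.ofCode (l.getD k 0)
  !decide (Encodable.encode t.1 < l.length ∧ Encodable.encode (t.1 ++ [false]) < l.length ∧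
    Encodable.encode (t.1 ++ [true]) < l.length ∧ t.2 < l.length) ||
  entryCheck R p q K (t, e (Encodable.encode t.1), e (Encodable.encode (t.1 ++ [false])),
    e (Encodable.encode (t.1 ++ [true])), e t.2)

theorem Primrec.nat_pow : Primrec₂ fun m n : ℕ => m ^ n :=
  Primrec₂.unpaired'.1 Nat.Primrec.pow

theorem computable_entryCheck {R : List Bool × List ℕ → Bool} (hR : Computable R) (p q K : ℕ) :
    Computable (entryCheck R p q K) := by
  let X := (List Bool × ℕ) × MassEntry × MassEntry × MassEntry × MassEntry
  have hσ : Primrec fun t : X => t.1.1 := Primrec.fst.comp Primrec.fst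
  have hi : Primrec fun t : X => t.1.2 := Primrec.snd.comp Primrec.fst
  have hlen : Primrec fun t : X => t.1.1.length := Primrec.list_length.comp hσ
  have hu : Primrec fun t : X => t.2.1 := Primrec.fst.comp Primrec.snd
  have hN : Primrec fun t : X => t.2.1.1 := Primrec.fst.comp hu
  have hτ : Primrec fun t : X => t.2.1.2.2 := Primrec.snd.comp (Primrec.snd.comp hu)
  have h2 : Primrec fun t : X => t.2.2 := Primrec.snd.comp Primrec.snd
  have hN0 : Primrec fun t : X => t.2.2.1.1 := Primrec.fst.comp (Primrec.fst.comp h2)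
  have hN1 : Primrec fun t : X => t.2.2.2.1.1 :=
    Primrec.fst.comp (Primrec.fst.comp (Primrec.snd.comp h2))
  have hb : Primrec fun t : X => t.2.2.2.2.2.1 :=
    Primrec.fst.comp (Primrec.snd.comp (Primrec.snd.comp (Primrec.snd.comp h2)))
  have c (n : ℕ) : Primrec fun _ : X => n := Primrec.const n
  have d1 : PrimrecPred fun t : X => ¬ t.1.1.length = 0 ∨ 0 < t.2.1.1 :=
    (Primrec.eq.comp hlen (c 0)).not.or (Primrec.nat_lt.comp (c 0) hN)
  have d2 : PrimrecPred fun t : X => 4 * t.2.1.1 ≤ t.2.2.1.1 + t.2.2.2.1.1 :=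
    Primrec.nat_le.comp (Primrec.nat_mul.comp (c 4) hN) (Primrec.nat_add.comp hN0 hN1)
  have d3 : PrimrecPred fun t : X =>
      t.2.1.1 ^ q * 2 ^ (p * t.1.1.length) ≤ (4 ^ t.1.1.length * K) ^ q :=
    Primrec.nat_le.comp
      (Primrec.nat_mul.comp (Primrec.nat_pow.comp hN (c q))
        (Primrec.nat_pow.comp (c 2) (Primrec.nat_mul.comp (c p) hlen)))
      (Primrec.nat_pow.comp (Primrec.nat_mul.comp (Primrec.nat_pow.comp (c 4) hlen) (c K)) (c q))
  have d4 : PrimrecPred fun t : X => t.2.1.1 = 0 := Primrec.eq.comp hN (c 0)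
  have d5 : PrimrecPred fun t : X => t.2.1.2.2.length = t.1.1.length ∧
      t.2.1.2.2.getD t.1.2 0 ≤ t.2.2.2.2.2.1 :=
    (Primrec.eq.comp (Primrec.list_length.comp hτ) hlen).and
      (Primrec.nat_le.comp ((Primrec.list_getD 0).comp hτ hi) hb)
  have hRc : Computable fun t : X => R (t.1.1.take t.1.2, t.2.1.2.2.take t.1.2) :=
    hR.comp ((Primrec.list_take.comp hi hσ).pair (Primrec.list_take.comp hi hτ)).to_comp
  exact Primrec.and.to_comp.comp (d1.and (d2.and d3)).decide.to_comp
    (Primrec.or.to_comp.comp d4.decide.to_comp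
      (Primrec.and.to_comp.comp d5.decide.to_comp hRc))

theorem computable_prefixCheck {R : List Bool × List ℕ → Bool} (hR : Computable R) (p q K : ℕ) :
    Computable (prefixCheck R p q K) := by
  have ht : Primrec fun l : List ℕ =>
      ((Encodable.decode l.length.unpair.1 : Option (List Bool × ℕ)).getD ([], 0)) :=
    Primrec.option_getD.comp (Primrec.decode.comp (Primrec.fst.comp
      (Primrec.unpair.comp Primrec.list_length))) (Primrec.const _)
  have hσ := Primrec.fst.comp ht
  have he := Primrec.encode.comp hσ
  have hc (b : Bool) := Primrec.encode.comp (Primrec.list_concat.comp hσ (Primrec.const b))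
  have hi := Primrec.snd.comp ht
  have he' {f : List ℕ → ℕ} (hf : Primrec f) :
      Primrec fun l : List ℕ => MassEntry.ofCode (l.getD (f l) 0) :=
    MassEntry.primrec_ofCode.comp ((Primrec.list_getD 0).comp Primrec.id hf)
  have hl {f : List ℕ → ℕ} (hf : Primrec f) : PrimrecPred fun l : List ℕ => f l < l.length :=
    Primrec.nat_lt.comp hf Primrec.list_length
  exact Primrec.or.to_comp.comp
    (Primrec.not.comp ((hl he).and ((hl (hc false)).and ((hl (hc true)).and (hl hi)))).decide).to_comp
    ((computable_entryCheck hR p q K).comp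
      (ht.pair ((he' he).pair ((he' (hc false)).pair ((he' (hc true)).pair (he' hi))))).to_comp)

theorem forall_prefixCheck_iff {R : List Bool × List ℕ → Bool} {p q K : ℕ} {f : ℕ → ℕ} :
    (∀ n, prefixCheck R p q K (initSeg f n) = true) ↔ ∀ (σ : List Bool) (i : ℕ),
      entryCheck R p q K ((σ, i), MassEntry.ofCode (f (Encodable.encode σ)),
        MassEntry.ofCode (f (Encodable.encode (σ ++ [false]))),
        MassEntry.ofCode (f (Encodable.encode (σ ++ [true]))), MassEntry.ofCode (f i)) = true := by
  have hget {n k : ℕ} (h : k < n) : (initSeg f n).getD k 0 = f k := by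
    rw [List.getD_eq_getElem?_getD, getElem?_initSeg f h, Option.getD_some]
  constructor
  · intro h σ i
    -- The first component of the length names the condition to be tested; the second makes the
    -- length exceed every position that the test reads.
    let b := Encodable.encode σ + Encodable.encode (σ ++ [false]) +
      Encodable.encode (σ ++ [true]) + i + 1
    have hb := Nat.right_le_pair (Encodable.encode (σ, i)) b
    have := h (Nat.pair (Encodable.encode (σ, i)) b)
    simp only [prefixCheck, length_initSeg, Nat.unpair_pair, Encodable.encodek,
      Option.getD_some] at this
    have h1 : Encodable.encode σ < Nat.pair (Encodable.encode (σ, i)) b := by omega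
    have h2 : Encodable.encode (σ ++ [false]) < Nat.pair (Encodable.encode (σ, i)) b := by omega
    have h3 : Encodable.encode (σ ++ [true]) < Nat.pair (Encodable.encode (σ, i)) b := by omega
    have h4 : i < Nat.pair (Encodable.encode (σ, i)) b := by omega
    rw [hget h1, hget h2, hget h3, hget h4, decide_eq_true ⟨h1, h2, h3, h4⟩] at this
    simpa using this
  · intro h n
    simp only [prefixCheck, length_initSeg]
    generalize (Encodable.decode n.unpair.1 : Option (List Bool × ℕ)).getD ([], 0) = t
    by_cases hb : Encodable.encode t.1 < n ∧ Encodable.encode (t.1 ++ [false]) < n ∧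
      Encodable.encode (t.1 ++ [true]) < n ∧ t.2 < n
    · rw [hget hb.1, hget hb.2.1, hget hb.2.2.1, hget hb.2.2.2, h t.1 t.2, Bool.or_true]
    · rw [decide_eq_false hb]; rfl

/-- Taking `q`-th powers turns the weight `2 ^ (-k * s)` into `2 ^ (-k * p)`. This is where
rationality of `s` makes the condition on masses decidable. -/
theorem natCast_le_cantorWeight_mul_iff {s : ℝ} {p q : ℕ} (hq : q ≠ 0) (hs : s * q = p)
    (N k K : ℕ) : (N : ℝ≥0∞) ≤ cantorWeight s k * (4 ^ k * K) ↔
      N ^ q * 2 ^ (p * k) ≤ (4 ^ k * K) ^ q := by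
  have hw : cantorWeight s k ^ q = ((2 : ℝ≥0∞) ^ (p * k))⁻¹ := by
    rw [cantorWeight, ← ENNReal.rpow_mul_natCast, hs, ENNReal.rpow_natCast, ← pow_mul,
      ← ENNReal.inv_pow, mul_comm]
  have h0 : (2 : ℝ≥0∞) ^ (p * k) ≠ 0 := by simp
  have h1 : (2 : ℝ≥0∞) ^ (p * k) ≠ ⊤ := by simp
  rw [← ENNReal.pow_le_pow_left_iff hq, mul_pow, hw, ← ENNReal.mul_le_iff_le_inv h0 h1, mul_comm]
  exact_mod_cast Iff.rfl

/-- The class in Cantor space that a mass code describes: the support of its mass. -/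
def massSupport (f : ℕ → ℕ) : Set (ℕ → Bool) :=
  {x | ∀ n, 0 < (MassEntry.ofCode (f (Encodable.encode (initSeg x n)))).1}

/-- Along `x` the code supplies a witness string of each length, all below the bounds stored in the
same code; a limit point of these strings is an infinite witness. -/
theorem massSupport_subset {R : List Bool × List ℕ → Bool} {p q K : ℕ} {f : ℕ → ℕ}
    (hf : ∀ n, prefixCheck R p q K (initSeg f n) = true) :
    massSupport f ⊆ {x | ∃ g : ℕ → ℕ, ∀ n, R (initSeg x n, initSeg g n) = true} := by
  intro x hx
  rw [forall_prefixCheck_iff] at hf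
  let τ : ℕ → List ℕ := fun n => (MassEntry.ofCode (f (Encodable.encode (initSeg x n)))).2.2
  have hτ : ∀ n i, (τ n).length = n ∧ (τ n).getD i 0 ≤ (MassEntry.ofCode (f i)).2.1 ∧
      R (initSeg x (min i n), (τ n).take i) = true := fun n i => by
    have h := hf (initSeg x n) i
    have h0 := hx n
    simp only [entryCheck, Bool.and_eq_true, Bool.or_eq_true, decide_eq_true_eq, length_initSeg,
      take_initSeg] at h
    exact ⟨(h.2.resolve_left h0.ne').1.1, (h.2.resolve_left h0.ne').1.2,
      (h.2.resolve_left h0.ne').2⟩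
  have hseg : ∀ n m, m ≤ n → initSeg (fun i => (τ n).getD i 0) m = (τ n).take m := fun n m hm => by
    have hl := (hτ n 0).1
    refine List.ext_getElem (by simp [hl, hm]) fun i h1 h2 => ?_
    have hi : i < (τ n).length := by simp at h1; omega
    simp [initSeg, hi]
  obtain ⟨y, g, -, hlim⟩ := exists_limit_of_le (fun i => (MassEntry.ofCode (f i)).2.1)
    (fun _ => x) (fun n i => (τ n).getD i 0) fun n i => (hτ n i).2.1
  refine ⟨g, fun m => ?_⟩
  obtain ⟨n, hn, -, h2⟩ := hlim m m
  rw [← h2, hseg n m hn]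
  simpa [min_eq_left hn] using (hτ n m).2.2

theorem cantorHausdorff_massSupport_ne_zero {R : List Bool × List ℕ → Bool} {s : ℝ} (h0 : 0 < s)
    {p q K : ℕ} (hq : q ≠ 0) (hs : s * q = p) {f : ℕ → ℕ}
    (hf : ∀ n, prefixCheck R p q K (initSeg f n) = true) :
    cantorHausdorff s (massSupport f) ≠ 0 := by
  rw [forall_prefixCheck_iff] at hf
  have h (σ : List Bool) := (Bool.and_eq_true _ _ ▸ hf σ 0 : _ ∧ _).1
  simp only [decide_eq_true_eq] at h
  rw [cantorHausdorff_ne_zero_iff h0]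
  exact content_ne_zero_of_mass (K := K)
    (N := fun σ => (MassEntry.ofCode (f (Encodable.encode σ))).1)
    ((h []).1.resolve_left (by simp)) (fun σ => (h σ).2.1)
    (fun σ => (natCast_le_cantorWeight_mul_iff hq hs _ _ _).2 (h σ).2.2)

theorem exists_massCode {R : List Bool × List ℕ → Bool} {s : ℝ} (h0 : 0 < s) {p q : ℕ}
    (hq : q ≠ 0) (hs : s * q = p)
    (hE : cantorHausdorff s {x | ∃ g : ℕ → ℕ, ∀ n, R (initSeg x n, initSeg g n) = true} ≠ 0) :
    ∃ (K : ℕ) (f : ℕ → ℕ), ∀ n, prefixCheck R p q K (initSeg f n) = true := by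
  rw [cantorHausdorff_ne_zero_iff h0] at hE
  obtain ⟨h, hh⟩ := exists_bound_content_ne_zero R hE
  have hw : ∀ k, cantorWeight s k ≤ 1 := fun k =>
    ENNReal.rpow_le_one (pow_le_one' (by simp) k) h0.le
  obtain ⟨K, N, hN0, hNs, hNw, hNC⟩ := exists_mass hw hh
  have hτ : ∀ σ : List Bool, ∃ g : ℕ → ℕ, 0 < N σ → (∀ i, g i ≤ h i) ∧
      ∀ n ≤ σ.length, R (σ.take n, initSeg g n) = true := fun σ => by
    by_cases hσ : 0 < N σ
    · obtain ⟨x, ⟨g, hg, hgR⟩, hx⟩ := hNC σ hσ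
      refine ⟨g, fun _ => ⟨hg, fun n hn => ?_⟩⟩
      rw [← hx, take_initSeg, min_eq_left hn]
      exact hgR n
    · exact ⟨0, fun h => absurd h hσ⟩
  choose g hg using hτ
  -- The bound `h k` is stored at every `k`, since coordinates are indexed by all naturals; mass and
  -- witness matter only where `k` codes a string.
  let f : ℕ → ℕ := fun k => Encodable.encode (α := MassEntry)
    (match (Encodable.decode k : Option (List Bool)) with
      | some σ => (N σ, h k, initSeg (g σ) σ.length)
      | none => (0, h k, []))
  have hf (σ : List Bool) : MassEntry.ofCode (f (Encodable.encode σ)) =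
      (N σ, h (Encodable.encode σ), initSeg (g σ) σ.length) := by
    simp only [f, MassEntry.ofCode_encode, Encodable.encodek]
  have hfb (i : ℕ) : (MassEntry.ofCode (f i)).2.1 = h i := by
    simp only [f, MassEntry.ofCode_encode]
    split <;> rfl
  refine ⟨K, f, forall_prefixCheck_iff.2 fun σ i => ?_⟩
  simp only [entryCheck, hf, hfb, Bool.and_eq_true, Bool.or_eq_true, decide_eq_true_eq,
    length_initSeg, true_and]
  refine ⟨⟨?_, hNs σ, (natCast_le_cantorWeight_mul_iff hq hs _ _ _).1 (hNw σ)⟩, ?_⟩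
  · rcases σ with _ | ⟨a, σ⟩
    · exact Or.inr hN0
    · exact Or.inl (by simp)
  · rcases Nat.eq_zero_or_pos (N σ) with h | hpos
    · exact Or.inl h
    refine Or.inr ⟨?_, ?_⟩
    · rcases lt_or_ge i σ.length with hi | hi
      · rw [List.getD_eq_getElem?_getD, getElem?_initSeg _ hi, Option.getD_some]
        exact (hg σ hpos).1 i
      · rw [List.getD_eq_default _ _ (by simpa using hi)]
        exact Nat.zero_le _
    · rw [take_initSeg]
      rcases le_total i σ.length with hi | hi
      · rw [min_eq_left hi]
        exact (hg σ hpos).2 i hi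
      · rw [min_eq_right hi, List.take_of_length_le hi]
        simpa using (hg σ hpos).2 σ.length le_rfl

end Codes

/-! ### Well-foundedness of recursive trees reduces to Kleene's `O` -/

section KleeneO

open Nat.Partrec (Code)

/-- Keeps `1 = 2 ^ 0` from counting as a successor notation. -/
theorem KleeneLT.ne_zero {a b : ℕ} (h : KleeneLT a b) : a ≠ 0 ∧ b ≠ 0 := by
  induction h with
  | one_two => simp
  | succ _ ih => exact ⟨ih.2, by positivity⟩
  | lim c φ n _ _ ih => exact ⟨(ih n).1, by positivity⟩
  | trans _ _ ih1 ih2 => exact ⟨ih1.1, ih2.2⟩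

theorem KleeneLT.eq_one_or_exists_lt {a b : ℕ} (h : KleeneLT a b) :
    a = 1 ∨ ∃ a', KleeneLT a' a := by
  induction h with
  | one_two => exact Or.inl rfl
  | succ h _ => exact Or.inr ⟨_, h⟩
  | lim c φ n _ _ ih => exact ih n
  | trans _ _ ih _ => exact ih

theorem kleeneLT_two_pow {a : ℕ} (h : a ∈ KleeneO) : KleeneLT a (2 ^ a) := by
  obtain ⟨b, h | h⟩ := h
  · rcases h.eq_one_or_exists_lt with rfl | ⟨a', h'⟩
    · exact KleeneLT.one_two
    · exact h'.succ
  · exact h.succ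

theorem one_mem_kleeneO : 1 ∈ KleeneO := ⟨2, Or.inl KleeneLT.one_two⟩

/-- The predecessors of a notation, by the shape of the notation. -/
theorem KleeneLT.cases_right {x y : ℕ} (h : KleeneLT x y) :
    (∃ b, b ≠ 0 ∧ y = 2 ^ b ∧ (x = b ∨ KleeneLT x b)) ∨
    ∃ (c : Code) (φ : ℕ → ℕ), y = 3 * 5 ^ Encodable.encode c ∧ (∀ k, φ k ∈ c.eval k) ∧
      (∀ k, KleeneLT (φ k) (φ (k + 1))) ∧ ∃ n, KleeneLT x (φ n) := by
  induction h with
  | one_two => exact Or.inl ⟨1, by simp⟩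
  | succ h _ => exact Or.inl ⟨_, h.ne_zero.2, rfl, Or.inl rfl⟩
  | lim c φ n h1 h2 _ => exact Or.inr ⟨c, φ, rfl, h1, h2, n + 1, h2 n⟩
  | trans hxz _ _ ih =>
    rcases ih with ⟨b, hb, hy, rfl | hz⟩ | ⟨c, φ, hy, h1, h2, n, hn⟩
    · exact Or.inl ⟨_, hb, hy, Or.inr hxz⟩
    · exact Or.inl ⟨b, hb, hy, Or.inr (hxz.trans hz)⟩
    · exact Or.inr ⟨c, φ, hy, h1, h2, n, hxz.trans hn⟩

theorem two_pow_ne_three_mul {b e : ℕ} : 2 ^ b ≠ 3 * 5 ^ e := by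
  intro h
  have h3 : 3 ∣ 2 ^ b := h ▸ dvd_mul_right 3 _
  exact absurd (Nat.prime_three.dvd_of_dvd_pow h3) (by norm_num)

theorem three_mul_five_pow_encode_injective {c d : Code}
    (h : 3 * 5 ^ Encodable.encode c = 3 * 5 ^ Encodable.encode d) : c = d :=
  Encodable.encode_injective (Nat.pow_right_injective (by norm_num : 2 ≤ 5)
    (Nat.eq_of_mul_eq_mul_left (by norm_num) h))

/-- A notation has only one shape, and the code in a limit notation determines its fundamental
sequence. So everything below a notation is at or below the notations from which it was built. -/
theorem KleeneLT.acc {a b : ℕ} (h : KleeneLT a b) : Acc KleeneLT a ∧ Acc KleeneLT b := by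
  have hpow {b : ℕ} (hb : Acc KleeneLT b) : Acc KleeneLT (2 ^ b) := ⟨_, fun x hx => by
    rcases hx.cases_right with ⟨b', -, hy, h⟩ | ⟨c, φ, hy, -⟩
    · obtain rfl := Nat.pow_right_injective le_rfl hy
      rcases h with rfl | h
      · exact hb
      · exact hb.inv h
    · exact absurd hy two_pow_ne_three_mul⟩
  induction h with
  | one_two =>
    have h1 : Acc KleeneLT 1 := ⟨_, fun x hx => by
      rcases hx.cases_right with ⟨b', hb', hy, -⟩ | ⟨c, φ, hy, -⟩
      · exact absurd (Nat.pow_eq_one.1 hy.symm) (by simp [hb'])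
      · exact absurd (pow_zero 2 ▸ hy) (two_pow_ne_three_mul (b := 0))⟩
    exact ⟨h1, hpow h1⟩
  | succ _ ih => exact ⟨ih.2, hpow ih.2⟩
  | lim c φ n h1 _ ih =>
    refine ⟨(ih n).1, _, fun x hx => ?_⟩
    rcases hx.cases_right with ⟨b', -, hy, -⟩ | ⟨c', φ', hy, h1', -, m, hm⟩
    · exact absurd hy.symm two_pow_ne_three_mul
    · obtain rfl := three_mul_five_pow_encode_injective hy
      rw [Part.mem_unique (h1' m) (h1 m)] at hm
      exact (ih m).1.inv hm
  | trans _ _ ih1 ih2 => exact ⟨ih1.1, ih2.2⟩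

theorem acc_of_mem_kleeneO {a : ℕ} (h : a ∈ KleeneO) : Acc KleeneLT a := by
  obtain ⟨b, h | h⟩ := h
  · exact h.acc.1
  · exact h.acc.2

/-- If a limit notation is in `O`, then so is its fundamental sequence, which lies below it. -/
theorem kleeneLT_of_lim_mem {c : Code} {φ : ℕ → ℕ} (hφ : ∀ k, φ k ∈ c.eval k)
    (h : 3 * 5 ^ Encodable.encode c ∈ KleeneO) (n : ℕ) :
    KleeneLT (φ n) (3 * 5 ^ Encodable.encode c) := by
  have hp : ∃ a, KleeneLT a (3 * 5 ^ Encodable.encode c) := by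
    obtain ⟨b, h | h⟩ := h
    · refine h.eq_one_or_exists_lt.resolve_left fun h1 => ?_
      exact two_pow_ne_three_mul (b := 0) (h1 ▸ pow_zero 2)
    · exact ⟨b, h⟩
  obtain ⟨a, ha⟩ := hp
  rcases ha.cases_right with ⟨b', -, hy, -⟩ | ⟨c', φ', hy, h1, h2, -⟩
  · exact absurd hy.symm two_pow_ne_three_mul
  · obtain rfl := three_mul_five_pow_encode_injective hy
    rw [Part.mem_unique (hφ n) (h1 n)]
    exact KleeneLT.lim c φ' n h1 h2

/-- The limit notation whose fundamental sequence the code `c` computes from the parameters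
`σ` and `a`. -/
def limNotation (c : Code) (σ : List ℕ) (a : ℕ) : ℕ :=
  3 * 5 ^ Encodable.encode (c.curry (Encodable.encode (σ, a)))

/-- The fundamental sequence that starts at `a` and passes a limit notation for each child of
`σ` if `Q σ` holds. -/
def fundSeq (Q : List ℕ → Bool) (c : Code) (σ : List ℕ) (a n : ℕ) : ℕ :=
  Nat.rec a (fun n b => bif Q σ then limNotation c (σ ++ [n]) b else 2 ^ b) n

theorem fundSeq_succ (Q : List ℕ → Bool) (c : Code) (σ : List ℕ) (a n : ℕ) :
    fundSeq Q c σ a (n + 1) = bif Q σ then limNotation c (σ ++ [n]) (fundSeq Q c σ a n)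
      else 2 ^ fundSeq Q c σ a n := rfl

theorem primrec_limNotation : Primrec fun t : Code × List ℕ × ℕ => limNotation t.1 t.2.1 t.2.2 :=
  Primrec.nat_mul.comp (Primrec.const 3) (Primrec.nat_pow.comp (Primrec.const 5)
    (Primrec.encode.comp (Nat.Partrec.Code.primrec₂_curry.comp Primrec.fst
      (Primrec.encode.comp Primrec.snd))))

theorem computable_fundSeq {Q : List ℕ → Bool} (hQ : Computable Q) :
    Computable fun t : (Code × List ℕ × ℕ) × ℕ => fundSeq Q t.1.1 t.1.2.1 t.1.2.2 t.2 := by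
  have hc : Primrec fun t : ((Code × List ℕ × ℕ) × ℕ) × ℕ × ℕ => t.1.1.1 :=
    Primrec.fst.comp (Primrec.fst.comp Primrec.fst)
  have hσ : Primrec fun t : ((Code × List ℕ × ℕ) × ℕ) × ℕ × ℕ => t.1.1.2.1 :=
    Primrec.fst.comp (Primrec.snd.comp (Primrec.fst.comp Primrec.fst))
  have hn : Primrec fun t : ((Code × List ℕ × ℕ) × ℕ) × ℕ × ℕ => t.2.1 :=
    Primrec.fst.comp Primrec.snd
  have hb : Primrec fun t : ((Code × List ℕ × ℕ) × ℕ) × ℕ × ℕ => t.2.2 :=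
    Primrec.snd.comp Primrec.snd
  refine Computable.nat_rec (h := fun (t : (Code × List ℕ × ℕ) × ℕ) (u : ℕ × ℕ) =>
    bif Q t.1.2.1 then limNotation t.1.1 (t.1.2.1 ++ [u.1]) u.2 else 2 ^ u.2)
    Computable.snd (Computable.snd.comp (Computable.snd.comp Computable.fst)) ?_
  exact Computable.cond (hQ.comp hσ.to_comp)
    (primrec_limNotation.comp (hc.pair ((Primrec.list_concat.comp hσ hn).pair hb))).to_comp
    (Primrec.nat_pow.comp (Primrec.const 2) hb).to_comp

/-- The sequence mentions the code that computes it, so the recursion theorem is needed. -/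
theorem exists_code_fundSeq {Q : List ℕ → Bool} (hQ : Computable Q) :
    ∃ c : Code, ∀ σ a n,
      fundSeq Q c σ a n ∈ (c.curry (Encodable.encode (σ, a))).eval n := by
  have hdec : Primrec fun m : ℕ =>
      ((Encodable.decode m.unpair.1 : Option (List ℕ × ℕ)).getD ([], 0)) :=
    Primrec.option_getD.comp (Primrec.decode.comp (Primrec.fst.comp Primrec.unpair))
      (Primrec.const _)
  have harg : Primrec fun t : Code × ℕ =>
      ((t.1, (Encodable.decode t.2.unpair.1 : Option (List ℕ × ℕ)).getD ([], 0)),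
        t.2.unpair.2) :=
    (Primrec.fst.pair (hdec.comp Primrec.snd)).pair
      (Primrec.snd.comp (Primrec.unpair.comp Primrec.snd))
  have hF := (computable_fundSeq hQ).comp harg.to_comp
  obtain ⟨c, hc⟩ := Nat.Partrec.Code.fixed_point₂ (f := fun c m =>
    Part.some (fundSeq Q c ((Encodable.decode m.unpair.1 : Option (List ℕ × ℕ)).getD ([], 0)).1
      ((Encodable.decode m.unpair.1 : Option (List ℕ × ℕ)).getD ([], 0)).2 m.unpair.2))
    hF.partrec
  refine ⟨c, fun σ a n => ?_⟩
  rw [Nat.Partrec.Code.eval_curry, hc]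
  simp

/-- The relation of being a child of a string that satisfies `Q`. -/
def ChildRel (Q : List ℕ → Bool) (τ σ : List ℕ) : Prop :=
  Q σ = true ∧ ∃ a, τ = σ ++ [a]

section

variable {Q : List ℕ → Bool} {c : Code}

/-- By induction on the subtree, each term of the fundamental sequence lies below the next: through
the child's limit notation if `Q σ` holds, through a successor otherwise. Allowing any starting
notation `a` lets the children's notations be chained. -/
theorem lt_limNotation_of_acc
    (hc : ∀ σ a n, fundSeq Q c σ a n ∈ (c.curry (Encodable.encode (σ, a))).eval n)
    {σ : List ℕ} (hσ : Acc (ChildRel Q) σ) :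
    ∀ a ∈ KleeneO, KleeneLT a (limNotation c σ a) := by
  induction hσ with
  | intro σ _ ih =>
    intro a ha
    have hstep (n : ℕ) (hn : fundSeq Q c σ a n ∈ KleeneO) :
        KleeneLT (fundSeq Q c σ a n) (fundSeq Q c σ a (n + 1)) := by
      rw [fundSeq_succ]
      cases hQ : Q σ
      · exact kleeneLT_two_pow hn
      · exact ih _ ⟨hQ, n, rfl⟩ _ hn
    have hmem (n : ℕ) : fundSeq Q c σ a n ∈ KleeneO := by
      induction n with
      | zero => exact ha
      | succ n ih => exact ⟨_, Or.inr (hstep n ih)⟩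
    exact KleeneLT.lim _ (fundSeq Q c σ a) 0 (hc σ a) fun n => hstep n (hmem n)

/-- If `Q σ` holds, the terms after the first are the limit notations of the children and lie below
that of `σ`; well-foundedness of `<_O` on `O` thus transfers to the tree. -/
theorem acc_of_limNotation_mem
    (hc : ∀ σ a n, fundSeq Q c σ a n ∈ (c.curry (Encodable.encode (σ, a))).eval n)
    (σ : List ℕ) (a : ℕ) (h : limNotation c σ a ∈ KleeneO) : Acc (ChildRel Q) σ := by
  have hx := acc_of_mem_kleeneO h
  generalize hy : limNotation c σ a = y at hx
  induction hx generalizing σ a with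
  | intro y _ ih =>
    refine ⟨_, ?_⟩
    rintro τ ⟨hQ, n, rfl⟩
    have hlt : KleeneLT (fundSeq Q c σ a (n + 1)) (limNotation c σ a) :=
      kleeneLT_of_lim_mem (hc σ a) h (n + 1)
    rw [fundSeq_succ, hQ, cond_true] at hlt
    exact ih _ (hy ▸ hlt) _ _ ⟨_, Or.inl hlt⟩ rfl

/-- Well-foundedness of the subtrees of a recursive tree is many-one reducible to `O`. -/
theorem exists_computable_mem_kleeneO_iff (hQ : Computable Q) :
    ∃ t : List ℕ → ℕ, Computable t ∧ ∀ σ, t σ ∈ KleeneO ↔ Acc (ChildRel Q) σ := by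
  obtain ⟨c, hc⟩ := exists_code_fundSeq hQ
  refine ⟨fun σ => limNotation c σ 1, ?_, fun σ => ⟨acc_of_limNotation_mem hc σ 1, fun h =>
    ⟨_, Or.inr (lt_limNotation_of_acc hc h 1 one_mem_kleeneO)⟩⟩⟩
  exact (primrec_limNotation.comp ((Primrec.const c).pair
    (Primrec.id.pair (Primrec.const 1)))).to_comp

end

end KleeneO

/-! ### Paths recursive in an oracle -/

section Basis

theorem Nat.RecursiveIn.comp_total {O : Set (ℕ →. ℕ)} {f g : ℕ → ℕ}
    (hf : Nat.RecursiveIn O fun n => Part.some (f n))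
    (hg : Nat.RecursiveIn O fun n => Part.some (g n)) :
    Nat.RecursiveIn O fun n => Part.some (f (g n)) :=
  (Nat.RecursiveIn.comp hf hg).of_eq fun n => by simp

theorem Primrec.natRecursiveIn {O : Set (ℕ →. ℕ)} {f : ℕ → ℕ} (hf : Primrec f) :
    Nat.RecursiveIn O fun n => Part.some (f n) :=
  (Primrec.nat_iff.1 hf).recursiveIn

/-- A nonempty class of infinite sequences given by a tree without dead ends that is decidable from
an oracle has a member recursive in the oracle. -/
theorem exists_path_recursiveIn {O : Set (ℕ →. ℕ)} {P : List ℕ → Prop} {χ : ℕ → ℕ}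
    (hχ : Nat.RecursiveIn O fun n => Part.some (χ n))
    (h : ∀ σ, χ (Encodable.encode σ) = 0 ↔ P σ) (h0 : P [])
    (hs : ∀ σ, P σ → ∃ a, P (σ ++ [a])) :
    ∃ f : ℕ → ℕ, Nat.RecursiveIn O (fun n => Part.some (f n)) ∧ ∀ n, P (initSeg f n) := by
  classical
  -- The least good extension is chosen because unbounded search finds it.
  have hmin : ∀ σ, ∃ a, P σ → P (σ ++ [a]) ∧ ∀ b < a, ¬ P (σ ++ [b]) := fun σ => by
    by_cases hσ : P σ
    · exact ⟨Nat.find (hs σ hσ), fun _ => ⟨Nat.find_spec (hs σ hσ), fun b => Nat.find_min _⟩⟩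
    · exact ⟨0, fun h => absurd h hσ⟩
  choose next hnext using hmin
  let T : ℕ → List ℕ := fun n => Nat.rec [] (fun _ σ => σ ++ [next σ]) n
  have hT (n : ℕ) : P (T n) := by
    induction n with
    | zero => exact h0
    | succ n ih => exact (hnext _ ih).1
  have hTf (n : ℕ) : initSeg (fun n => next (T n)) n = T n := by
    induction n with
    | zero => rfl
    | succ n ih => rw [initSeg_succ, ih]
  let dec : ℕ → List ℕ := fun n => (Encodable.decode n).getD []
  have hdec (σ : List ℕ) : dec (Encodable.encode σ) = σ := by simp [dec]
  have hdecp : Primrec dec := Primrec.option_getD.comp Primrec.decode (Primrec.const _)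
  let snoc : ℕ → ℕ := fun k => Encodable.encode (dec k.unpair.1 ++ [k.unpair.2])
  have hsnoc : Primrec snoc := Primrec.encode.comp (Primrec.list_concat.comp
    (hdecp.comp (Primrec.fst.comp Primrec.unpair)) (Primrec.snd.comp Primrec.unpair))
  have hsnoc' (σ : List ℕ) (a : ℕ) :
      snoc (Nat.pair (Encodable.encode σ) a) = Encodable.encode (σ ++ [a]) := by
    simp only [snoc, Nat.unpair_pair, hdec]
  have hstep := Nat.RecursiveIn.comp hsnoc.natRecursiveIn (Nat.RecursiveIn.pair
    (Primrec.id.natRecursiveIn (O := O))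
    (Nat.RecursiveIn.rfind (hχ.comp_total hsnoc.natRecursiveIn)))
  have hG := Nat.RecursiveIn.prec
    ((Primrec.const (Encodable.encode ([] : List ℕ))).natRecursiveIn (O := O))
    (hstep.comp ((Primrec.snd.comp (Primrec.unpair.comp
      (Primrec.snd.comp Primrec.unpair))).natRecursiveIn))
  have hG' := hG.comp ((Primrec₂.natPair.comp (Primrec.const 0) Primrec.id).natRecursiveIn (O := O))
  have hTrec : Nat.RecursiveIn O fun n => Part.some (Encodable.encode (T n)) := by
    refine hG'.of_eq_tot fun n => ?_
    simp only [id, Part.bind_eq_bind, Part.bind_some, Nat.unpair_pair]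
    induction n with
    | zero => exact Part.mem_some _
    | succ n ih =>
      refine Part.mem_bind_iff.2 ⟨_, ih, ?_⟩
      have hr : next (T n) ∈ Nat.rfind fun a => (fun m => decide (m = 0)) <$>
          (Part.some (χ (snoc (Nat.pair (Encodable.encode (T n)) a))) : Part ℕ) := by
        have hn := hnext _ (hT n)
        refine Nat.mem_rfind.2 ⟨?_, fun {m} hm => ?_⟩
        · simpa [hsnoc', h] using hn.1
        · simpa [hsnoc', h] using hn.2 m hm
      refine Part.mem_bind_iff.2 ⟨Nat.pair (Encodable.encode (T n)) (next (T n)), ?_, ?_⟩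
      · rw [Part.eq_some_iff.2 hr]
        simp [Seq.seq]
      · rw [hsnoc']
        exact Part.mem_some _
  refine ⟨fun n => next (T n), ?_, fun n => (hTf n).symm ▸ hT n⟩
  -- The value at `n` is read off as the last entry of `T (n + 1)`.
  have hget : Primrec fun k : ℕ => (dec k).getD ((dec k).length - 1) 0 :=
    (Primrec.list_getD 0).comp hdecp (Primrec.nat_sub.comp
      (Primrec.list_length.comp hdecp) (Primrec.const 1))
  refine (hget.natRecursiveIn.comp_total (hTrec.comp_total Primrec.succ.natRecursiveIn)).of_eq
    fun n => ?_
  have : T (n + 1) = T n ++ [next (T n)] := rfl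
  simp [hdec, this]

/-- A nonempty lightface `Π⁰₁` class in Baire space has a member recursive in `O`. -/
theorem exists_recursiveIn_kleeneOChar {Q : List ℕ → Bool} (hQ : Computable Q)
    (hne : ∃ f : ℕ → ℕ, ∀ n, Q (initSeg f n) = true) :
    ∃ f : ℕ → ℕ, Nat.RecursiveIn {(kleeneOChar : ℕ →. ℕ)} (fun n => Part.some (f n)) ∧
      ∀ n, Q (initSeg f n) = true := by
  obtain ⟨t, ht, htO⟩ := exists_computable_mem_kleeneO_iff hQ
  have hdec : Computable fun n => t ((Encodable.decode n).getD []) :=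
    ht.comp (Primrec.option_getD.comp Primrec.decode (Primrec.const _)).to_comp
  -- This function vanishes exactly at the codes of strings whose subtree is ill-founded.
  have hχ : Nat.RecursiveIn {(kleeneOChar : ℕ →. ℕ)}
      fun n => Part.some (kleeneOChar (t ((Encodable.decode n).getD []))) :=
    Nat.RecursiveIn.comp_total (Nat.RecursiveIn.oracle _ rfl)
      (Partrec.nat_iff.1 hdec.partrec).recursiveIn
  have hroot : ¬ Acc (ChildRel Q) [] := by
    obtain ⟨f, hf⟩ := hne
    intro hacc
    have key : ∀ σ, Acc (ChildRel Q) σ → ∀ n, σ ≠ initSeg f n := fun σ hσ => by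
      induction hσ with
      | intro σ _ ih =>
        rintro n rfl
        exact ih (initSeg f (n + 1)) ⟨hf n, f n, initSeg_succ f n⟩ (n + 1) rfl
    exact key [] hacc 0 rfl
  have hacc (σ : List ℕ) (hσ : ¬ Acc (ChildRel Q) σ) :
      Q σ = true ∧ ∃ a, ¬ Acc (ChildRel Q) (σ ++ [a]) := by
    by_contra! hcon
    refine hσ ⟨_, ?_⟩
    rintro τ ⟨hQσ, a, rfl⟩
    exact hcon hQσ a
  obtain ⟨f, hf, hfP⟩ := exists_path_recursiveIn (P := fun σ => ¬ Acc (ChildRel Q) σ) hχ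
    (fun σ => by simp [kleeneOChar, htO]) hroot fun σ hσ => (hacc σ hσ).2
  exact ⟨f, hf, fun n => (hacc _ (hfP n)).1⟩

theorem isPi01In_massSupport {f F : ℕ → ℕ}
    (hf : Nat.RecursiveIn {(F : ℕ →. ℕ)} fun n => Part.some (f n)) :
    IsPi01In F (massSupport f) := by
  refine ⟨fun ξ => decide (0 < (MassEntry.ofCode (f (Encodable.encode ξ))).1), ?_, ?_⟩
  · have hpost : Primrec fun n : ℕ =>
        Encodable.encode (decide (0 < (MassEntry.ofCode n).1)) :=
      Primrec.encode.comp (Primrec.nat_lt.comp (Primrec.const 0)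
        (Primrec.fst.comp MassEntry.primrec_ofCode)).decide
    have hpre : RecursiveIn {(F : ℕ →. ℕ)} fun ξ : List Bool => Part.some (Encodable.encode ξ) :=
      Primrec.encode.computableIn
    exact ((hpost.natRecursiveIn.comp_total hf).comp hpre).of_eq fun n => by
      cases (Encodable.decode n : Option (List Bool)) <;> simp
  · simp [massSupport]

theorem isSigma11_of_computable {Q : List ℕ → Bool} (hQ : Computable Q) :
    IsSigma11 {f : ℕ → ℕ | ∀ n, Q (initSeg f n) = true} :=
  ⟨fun t => Q t.1, hQ.comp Computable.fst, by simp⟩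

end Basis

/-! ### The two parts of the theorem -/

theorem mainTheorem2 (s : ℚ) (hs0 : 0 < s) (hs1 : s < 1) :
    (∀ B : Set (ℕ → ℕ), IsSigma11Basis B →
      ∀ E : Set (ℕ → Bool), IsSigma11 E → cantorHausdorff (s : ℝ) E ≠ 0 →
        ∃ f ∈ B, ∃ C : Set (ℕ → Bool), C ⊆ E ∧ IsPi01In f C ∧ cantorHausdorff (s : ℝ) C ≠ 0) ∧
    (∀ E : Set (ℕ → Bool), IsSigma11 E → cantorHausdorff (s : ℝ) E ≠ 0 →
      ∃ C : Set (ℕ → Bool), C ⊆ E ∧ IsPi01In kleeneOChar C ∧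
        cantorHausdorff (s : ℝ) C ≠ 0) := by
  have hsR : (0 : ℝ) < s := by exact_mod_cast hs0
  have hpq : (s : ℝ) * s.den = (s.num.toNat : ℝ) := by
    have h1 : ((s.num.toNat : ℤ) : ℚ) = s.num := by
      rw [Int.toNat_of_nonneg (Rat.num_pos.2 hs0).le]
    have h2 : s * s.den = (s.num.toNat : ℚ) := by
      rw [Rat.mul_den_eq_num, ← h1, Int.cast_natCast]
    exact_mod_cast h2
  constructor
  · rintro B hB E ⟨R, hR, rfl⟩ hE
    -- The number `K` is not part of the code: it is fixed here, and `f` only shows that the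
    -- resulting class of codes is nonempty.
    obtain ⟨K, f, hf⟩ := exists_massCode hsR s.den_nz hpq hE
    obtain ⟨g, hg, hgB⟩ := hB _ (isSigma11_of_computable (computable_prefixCheck hR _ _ K)) ⟨f, hf⟩
    exact ⟨g, hgB, massSupport g, massSupport_subset hg,
      isPi01In_massSupport (Nat.RecursiveIn.oracle _ rfl),
      cantorHausdorff_massSupport_ne_zero hsR s.den_nz hpq hg⟩
  · rintro E ⟨R, hR, rfl⟩ hE
    obtain ⟨K, hne⟩ := exists_massCode hsR s.den_nz hpq hE
    obtain ⟨g, hg, hgQ⟩ := exists_recursiveIn_kleeneOChar (computable_prefixCheck hR _ _ K) hne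
    exact ⟨massSupport g, massSupport_subset hgQ, isPi01In_massSupport hg,
      cantorHausdorff_massSupport_ne_zero hsR s.den_nz hpq hgQ⟩
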